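/- **Definitions.** A *support fabric* is a pair $\mathcal F=(I,\mathcal H)$ with $I$ a finite set and $\mathcal H$ a set of subsets of $I$ (the *strata*) such that $J'\subset J\in\mathcal H$ implies $J'\in\mathcal H$. For a set $A\subset\mathbb R^J_{\ge 0}$ let $[[A]]$ be the convex hull of $A+\mathbb R^J_{\ge0}$. A *polyhedra system* with denominator $d\in\mathbb Z_{>0}$ is a triple $\mathcal D=(\mathcal F;\{\Delta_J\}_{J\in\mathcal H},d)$ where each $\Delta_J\subset\mathbb R^J_{\ge0}$ is non-empty and of the form $[[A]]$ with $A\subset\frac1d\mathbb Z^J_{\ge0}$, and $\Delta_{J_1}$ is the image of $\Delta_{J_2}$ under the restriction map $\mathbb R^{J_2}\to\mathbb R^{J_1}$ whenever $J_1\subset J_2$ are strata. If $d=1$ it is a *Newton polyhedra system*. Put $N(\mathcal D)=(\mathcal F;\{d\Delta_J\},1)$ and $\mathcal D/d'=(\mathcal F;\{\frac1{d'}\Delta_J\},dd')$ for an integer $d'\ge1$. The *contact exponent* is $\delta(\Delta_J)=\min\{\sum_{j\in J}\sigma(j):\sigma\in\Delta_J\}$ if $J\neq\emptyset$, and $\delta(\Delta_\emptyset)=-1$;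 moreover $\delta(\mathcal D)=\max_{J\in\mathcal H}\delta(\Delta_J)$ (which is $-\infty$ if $\mathcal H=\emptyset$) and $\mathrm{Sing}(\mathcal D)=\{J\in\mathcal H:\delta(\Delta_J)\ge1\}$. The *blow-up* of $\mathcal F$ centered in a non-empty $J\in\mathcal H$ is $\pi_J(\mathcal F)=(I\cup\{\infty\},\mathcal H')$, $\infty\notin I$, where $\mathcal H'$ consists of the strata $L\in\mathcal H$ with $J\not\subset L$ and of the sets $J'=(K\setminus J)\cup A\cup\{\infty\}$ with $J\subset K\in\mathcal H$ and $A\subsetneq J$; for the latter define $\lambda_{J'}:\mathbb R^K\to\mathbb R^{J'}$ by $\lambda_{J'}(\sigma)(j)=\sigma(j)$ for $j\ne\infty$ and $\lambda_{J'}(\sigma)(\infty)=\sum_{j\in J}\sigma(j)$. For $J\in\mathrm{Sing}(\mathcal D)$ the *characteristic transform* $\Lambda_J(\mathcal D)$ is the polyhedra system $(\pi_J(\mathcal F);\{\Delta'_{J'}\}_{J'\in\mathcal H'},d)$ with $\Delta'_{J'}=\Delta_{J'}$ if $\infty\notin J'$, and $\Delta'_{J'}=[[\lambda_{J'}(\Delta_K)]]-e_{\infty}$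 if $\infty\in J'$, where $e_\infty\in\mathbb R^{J'}$ is the standard basis vector of index $\infty$. For a Newton polyhedra system $\mathcal N$, an integer $d\ge1$ and $J\in\mathrm{Sing}(\mathcal N/d)$, the *$d$-moderated transform* of $\mathcal N$ centered in $J$ is $\Theta^d_J(\mathcal N)=N(\Lambda_J(\mathcal N/d))$. **Corollary.** Let $\mathcal N$ be a Newton polyhedra system and let $d\ge1$ be an integer. There are $k\ge0$ and a finite sequence $$\mathcal N=\mathcal N_0\to\mathcal N_1\to\cdots\to\mathcal N_k$$ in which each $\mathcal N_{i+1}$ is a $d$-moderated transform $\Theta^d_{J_i}(\mathcal N_i)$ of $\mathcal N_i$ centered in some $J_i\in\mathrm{Sing}(\mathcal N_i/d)$, such that $\delta(\mathcal N_k)<d$. -/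

import Mathlib

open scoped Pointwise

universe u

/-- A support fabric `(I, 𝓗)`: a finite index set `I` and a set `𝓗` of subsets of `I` (the strata)
that is open for the Zariski topology on the power set of `I`, i.e. stable under taking subsets. -/
structure SupportFabric where
  I : Type u
  [fintype : Fintype I]
  [decEq : DecidableEq I]
  strata : Set (Finset I)
  isOpen : ∀ J ∈ strata, ∀ J' ⊆ J, J' ∈ strata

attribute [instance] SupportFabric.fintype SupportFabric.decEq

namespace SupportFabric

/-- The strata `𝓗' = 𝓗'_s ∪ 𝓗'_∞` of the blow-up centered in `J`; the new index `∞` is `none`,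
and an old index `i` is `some i`. -/
def blowUpStrata (F : SupportFabric.{u}) (J : Finset F.I) : Set (Finset (Option F.I)) :=
  {J' | ∃ L ∈ F.strata, ¬ J ⊆ L ∧ J' = L.map Function.Embedding.some} ∪
  {J' | ∃ K ∈ F.strata, J ⊆ K ∧ ∃ A, A ⊂ J ∧ J' = Finset.insertNone ((K \ J) ∪ A)}

theorem blowUpStrata_isOpen (F : SupportFabric.{u}) (J : Finset F.I) :
    ∀ J' ∈ F.blowUpStrata J, ∀ J'' ⊆ J', J'' ∈ F.blowUpStrata J := by
  classical
  rintro J' (⟨L, hL, hJL, rfl⟩ | ⟨K, hK, hJK, A, hA, rfl⟩) M hM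
  · refine Or.inl ⟨M.eraseNone, F.isOpen L hL _ ?_, fun h => hJL (h.trans ?_), ?_⟩
    · intro x hx
      simpa using hM (Finset.mem_eraseNone.1 hx)
    · intro x hx
      simpa using hM (Finset.mem_eraseNone.1 hx)
    · ext x
      cases x with
      | none => simpa using fun h => by simpa using hM h
      | some x => simp
  · have hsub : ∀ x, some x ∈ M → (x ∈ K ∧ x ∉ J) ∨ x ∈ A := by
      intro x hx
      simpa using hM hx
    have hMK : M.eraseNone ⊆ K := by
      intro x hx
      rcases hsub x (Finset.mem_eraseNone.1 hx) with h | h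
      · exact h.1
      · exact hJK (hA.1 h)
    by_cases hn : none ∈ M
    · refine Or.inr ⟨(M.eraseNone \ J) ∪ J, F.isOpen K hK _ ?_, Finset.subset_union_right,
        M.eraseNone ∩ J, ?_, ?_⟩
      · exact Finset.union_subset (Finset.sdiff_subset.trans hMK) hJK
      · refine ⟨Finset.inter_subset_right, fun h => hA.2 fun x hx => ?_⟩
        have := (Finset.mem_inter.1 (h hx)).1
        rcases hsub x (Finset.mem_eraseNone.1 this) with h | h
        · exact absurd hx h.2
        · exact h
      · ext x
        cases x with
        | none => simpa using hn
        | some x => simp; tauto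
    · refine Or.inl ⟨M.eraseNone, F.isOpen K hK _ hMK, fun h => hA.2 fun x hx => ?_, ?_⟩
      · rcases hsub x (Finset.mem_eraseNone.1 (h hx)) with h | h
        · exact absurd hx h.2
        · exact h
      · ext x
        cases x with
        | none => simpa using hn
        | some x => simp

/-- The blow-up `π_J(F)` centered in `J` (meant for a non-empty stratum `J`). -/
def blowUp (F : SupportFabric.{u}) (J : Finset F.I) : SupportFabric.{u} where
  I := Option F.I
  strata := F.blowUpStrata J
  isOpen := F.blowUpStrata_isOpen J

/-- The map `π_J^#`: it sends `(K \ J) ∪ A ∪ {∞}` to `K` and is the identity on strata without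
`∞`; see `blowUpMap_insertNone` and `blowUpMap_map_some`. -/
def blowUpMap (F : SupportFabric.{u}) (J : Finset F.I) (J' : Finset (Option F.I)) : Finset F.I :=
  if none ∈ J' then J'.eraseNone ∪ J else J'.eraseNone

theorem blowUpMap_insertNone (F : SupportFabric.{u}) {J K A : Finset F.I} (hJK : J ⊆ K)
    (hA : A ⊂ J) : F.blowUpMap J (Finset.insertNone ((K \ J) ∪ A)) = K := by
  ext x
  have h1 : x ∈ J → x ∈ K := fun h => hJK h
  have h2 : x ∈ A → x ∈ J := fun h => hA.1 h
  simp [blowUpMap]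
  tauto

theorem blowUpMap_map_some (F : SupportFabric.{u}) (J L : Finset F.I) :
    F.blowUpMap J (L.map Function.Embedding.some) = L := by
  simp [blowUpMap]

theorem blowUpMap_mem (F : SupportFabric.{u}) {J : Finset F.I} {J' : Finset (Option F.I)}
    (h : J' ∈ F.blowUpStrata J) : F.blowUpMap J J' ∈ F.strata := by
  rcases h with ⟨L, hL, hJL, rfl⟩ | ⟨K, hK, hJK, A, hA, rfl⟩
  · rwa [blowUpMap_map_some]
  · rwa [blowUpMap_insertNone F hJK hA]

theorem mem_blowUpMap_of_some (F : SupportFabric.{u}) {J : Finset F.I}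
    {J' : Finset (Option F.I)} {i : F.I} (h : some i ∈ J') : i ∈ F.blowUpMap J J' := by
  unfold blowUpMap
  split_ifs <;> simp [h]

theorem subset_blowUpMap (F : SupportFabric.{u}) {J : Finset F.I}
    {J' : Finset (Option F.I)} (h : none ∈ J') : J ⊆ F.blowUpMap J J' := by
  simp [blowUpMap, h]

theorem blowUpMap_mono (F : SupportFabric.{u}) {J : Finset F.I}
    {J₁ J₂ : Finset (Option F.I)} (h : J₁ ⊆ J₂) : F.blowUpMap J J₁ ⊆ F.blowUpMap J J₂ := by
  intro x hx
  by_cases hn : none ∈ J₁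
  · simp only [blowUpMap, hn, h hn, if_true, Finset.mem_union, Finset.mem_eraseNone] at hx ⊢
    exact hx.imp (fun hx => h hx) id
  · simp only [blowUpMap, hn, if_false, Finset.mem_eraseNone] at hx
    exact F.mem_blowUpMap_of_some (h hx)

/-- The map `λ_{J'} : ℝ^K → ℝ^{J'}`, `K = π_J^#(J')`: coordinates `j ≠ ∞` are kept and the
coordinate `∞` (if `∞ ∈ J'`) is `∑_{j ∈ J} σ(j)`. If `∞ ∉ J'` it is the relabelling of
coordinates along `i ↦ some i`. -/
def blowUpLin (F : SupportFabric.{u}) (J : Finset F.I) (J' : Finset (Option F.I))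
    (σ : F.blowUpMap J J' → ℝ) : J' → ℝ
  | ⟨some i, h⟩ => σ ⟨i, F.mem_blowUpMap_of_some h⟩
  | ⟨none, h⟩ => ∑ j : J, σ ⟨j, F.subset_blowUpMap h j.2⟩

/-- The vector `e_{J',∞}`, the restriction to `J'` of the standard basis vector `e_∞`. -/
def eInfty {I : Type u} (J' : Finset (Option I)) : J' → ℝ
  | ⟨some _, _⟩ => 0
  | ⟨none, _⟩ => 1

end SupportFabric

/-- The positive convex hull `[[A]]`, the convex hull of `A + ℝ_{≥0}^J`. -/
def posConvexHull {ι : Type*} (A : Set (ι → ℝ)) : Set (ι → ℝ) :=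
  convexHull ℝ (A + {τ | ∀ j, 0 ≤ τ j})

/-- `Δ` is a characteristic polyhedron with denominator `d`: `Δ = [[A]]` for some
`A ⊆ (1/d) ℤ_{≥0}^J`. -/
def IsCharPolyhedron {ι : Type*} (d : ℕ) (Δ : Set (ι → ℝ)) : Prop :=
  ∃ A : Set (ι → ℝ), (∀ σ ∈ A, ∀ j, ∃ n : ℕ, σ j = (n : ℝ) / (d : ℝ)) ∧ Δ = posConvexHull A

/-- The contact exponent `δ(Δ) = min {|σ| ; σ ∈ Δ}` of a polyhedron `Δ ⊆ ℝ^J`, with the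
convention `-1` for `J = ∅`. (The minimum is attained when `Δ` is a non-empty characteristic
polyhedron.) -/
noncomputable def polyhedronContactExponent {I : Type u} {J : Finset I} (Δ : Set (J → ℝ)) : ℝ :=
  open Classical in
  if J = ∅ then -1 else sInf ((fun σ : J → ℝ => ∑ j, σ j) '' Δ)

/-- A polyhedra system `(F; {Δ_J}_{J ∈ 𝓗}, d)`, all of whose polyhedra are non-empty. -/
structure PolyhedraSystem where
  fabric : SupportFabric.{u}
  polyhedron : (J : fabric.strata) → Set (J.1 → ℝ)
  denom : ℕ
  denom_pos : 0 < denom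
  isChar : ∀ J, IsCharPolyhedron denom (polyhedron J)
  nonempty : ∀ J, (polyhedron J).Nonempty
  compat : ∀ (J₁ J₂ : fabric.strata) (h : (J₁ : Finset fabric.I) ⊆ (J₂ : Finset fabric.I)),
    polyhedron J₁ = Finset.restrict₂ (π := fun _ => ℝ) h '' polyhedron J₂

section PosConvexHull

variable {ι κ : Type*}

theorem convex_posOrthant : Convex ℝ {τ : ι → ℝ | ∀ j, 0 ≤ τ j} := by
  intro x hx y hy a b ha hb _ j
  exact add_nonneg (mul_nonneg ha (hx j)) (mul_nonneg hb (hy j))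

theorem posConvexHull_eq (A : Set (ι → ℝ)) :
    posConvexHull A = convexHull ℝ A + {τ | ∀ j, 0 ≤ τ j} := by
  rw [posConvexHull, convexHull_add, convex_posOrthant.convexHull_eq]

theorem subset_posConvexHull (A : Set (ι → ℝ)) : A ⊆ posConvexHull A := fun x hx =>
  subset_convexHull ℝ _ ⟨x, hx, 0, fun _ => le_rfl, add_zero x⟩

theorem posConvexHull_idem_aux {A : Set (ι → ℝ)} {x τ : ι → ℝ} (hx : x ∈ posConvexHull A)
    (hτ : ∀ j, 0 ≤ τ j) : x + τ ∈ posConvexHull A := by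
  rw [posConvexHull_eq] at hx ⊢
  obtain ⟨a, ha, t, ht, rfl⟩ := hx
  exact ⟨a, ha, t + τ, fun j => add_nonneg (ht j) (hτ j), (add_assoc _ _ _).symm⟩

theorem posConvexHull_min {A B : Set (ι → ℝ)} (h : A ⊆ posConvexHull B) :
    posConvexHull A ⊆ posConvexHull B := by
  refine convexHull_min ?_ (convex_convexHull ℝ _)
  rintro _ ⟨a, ha, t, ht, rfl⟩
  exact posConvexHull_idem_aux (h ha) ht

theorem posConvexHull_nonneg {A : Set (ι → ℝ)} (h : ∀ σ ∈ A, ∀ j, 0 ≤ σ j) :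
    ∀ σ ∈ posConvexHull A, ∀ j, 0 ≤ σ j := by
  refine convexHull_min ?_ convex_posOrthant
  rintro _ ⟨a, ha, t, ht, rfl⟩ j
  exact add_nonneg (h a ha j) (ht j)

/-- A linear map preserving the non-negative orthants is compatible with `[[·]]`. -/
theorem posConvexHull_image_posConvexHull (f : (ι → ℝ) →ₗ[ℝ] (κ → ℝ))
    (hf : ∀ τ, (∀ j, 0 ≤ τ j) → ∀ j, 0 ≤ f τ j) (A : Set (ι → ℝ)) :
    posConvexHull (f '' posConvexHull A) = posConvexHull (f '' A) := by
  apply subset_antisymm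
  · apply posConvexHull_min
    rintro _ ⟨x, hx, rfl⟩
    rw [posConvexHull_eq] at hx
    obtain ⟨a, ha, t, ht, rfl⟩ := hx
    rw [posConvexHull_eq, map_add]
    exact ⟨f a, by rw [← LinearMap.image_convexHull]; exact ⟨a, ha, rfl⟩, f t, hf t ht, rfl⟩
  · apply posConvexHull_min
    rintro _ ⟨x, hx, rfl⟩
    exact subset_posConvexHull _ ⟨x, subset_posConvexHull _ hx, rfl⟩

/-- A linear map carrying the non-negative orthant onto the other one commutes with `[[·]]`. -/
theorem image_posConvexHull (f : (ι → ℝ) →ₗ[ℝ] (κ → ℝ))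
    (hf : f '' {τ | ∀ j, 0 ≤ τ j} = {τ | ∀ j, 0 ≤ τ j}) (A : Set (ι → ℝ)) :
    f '' posConvexHull A = posConvexHull (f '' A) := by
  rw [posConvexHull_eq, posConvexHull_eq, Set.image_add, hf, ← LinearMap.image_convexHull]

end PosConvexHull

namespace SupportFabric

/-- `blowUpLin` as a linear map. -/
def blowUpLinearMap (F : SupportFabric.{u}) (J : Finset F.I) (J' : Finset (Option F.I)) :
    (F.blowUpMap J J' → ℝ) →ₗ[ℝ] (J' → ℝ) where
  toFun := F.blowUpLin J J'
  map_add' σ τ := by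
    ext ⟨j, hj⟩
    cases j with
    | none => simp [blowUpLin, Finset.sum_add_distrib]
    | some j => simp [blowUpLin]
  map_smul' c σ := by
    ext ⟨j, hj⟩
    cases j with
    | none => simp [blowUpLin, Finset.mul_sum]
    | some j => simp [blowUpLin]

theorem blowUpLin_nonneg (F : SupportFabric.{u}) (J : Finset F.I) (J' : Finset (Option F.I))
    (τ : F.blowUpMap J J' → ℝ) (h : ∀ j, 0 ≤ τ j) : ∀ j, 0 ≤ F.blowUpLin J J' τ j := by
  rintro ⟨j, hj⟩
  cases j with
  | none => exact Finset.sum_nonneg fun _ _ => h _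
  | some j => exact h _

theorem blowUpLin_restrict (F : SupportFabric.{u}) (J : Finset F.I)
    {J₁ J₂ : Finset (Option F.I)} (h : J₁ ⊆ J₂) (σ : F.blowUpMap J J₂ → ℝ) :
    F.blowUpLin J J₁ (Finset.restrict₂ (π := fun _ => ℝ) (F.blowUpMap_mono h) σ) =
      Finset.restrict₂ (π := fun _ => ℝ) h (F.blowUpLin J J₂ σ) := by
  ext ⟨j, hj⟩
  cases j with
  | none => rfl
  | some j => rfl

theorem eInfty_restrict {I : Type u} {J₁ J₂ : Finset (Option I)} (h : J₁ ⊆ J₂) :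
    Finset.restrict₂ (π := fun _ => ℝ) h (eInfty J₂) = eInfty J₁ := by
  ext ⟨j, hj⟩
  cases j with
  | none => rfl
  | some j => rfl

end SupportFabric

theorem restrict₂_image_posOrthant {I : Type u} {J₁ J₂ : Finset I} (h : J₁ ⊆ J₂) :
    (Finset.restrict₂ (π := fun _ => ℝ) h) '' {τ : J₂ → ℝ | ∀ j, 0 ≤ τ j} =
      {τ : J₁ → ℝ | ∀ j, 0 ≤ τ j} := by
  classical
  apply subset_antisymm
  · rintro _ ⟨τ, hτ, rfl⟩ j
    exact hτ _
  · intro τ hτ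
    refine ⟨fun j => if hj : j.1 ∈ J₁ then τ ⟨j.1, hj⟩ else 0, fun j => ?_, ?_⟩
    · by_cases hj : j.1 ∈ J₁
      · simpa [hj] using hτ ⟨j.1, hj⟩
      · simp [hj]
    · ext j
      simp [Finset.restrict₂]

theorem restrict₂_image_posConvexHull {I : Type u} {J₁ J₂ : Finset I} (h : J₁ ⊆ J₂)
    (A : Set (J₂ → ℝ)) :
    Finset.restrict₂ (π := fun _ => ℝ) h '' posConvexHull A =
      posConvexHull (Finset.restrict₂ (π := fun _ => ℝ) h '' A) :=
  image_posConvexHull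
    (f := { toFun := Finset.restrict₂ (π := fun _ => ℝ) h
            map_add' := fun _ _ => rfl
            map_smul' := fun _ _ => rfl })
    (restrict₂_image_posOrthant h) A

theorem smul_posConvexHull {ι : Type*} {c : ℝ} (hc : 0 < c) (A : Set (ι → ℝ)) :
    c • posConvexHull A = posConvexHull (c • A) := by
  refine image_posConvexHull (f := c • LinearMap.id) ?_ A
  apply subset_antisymm
  · rintro _ ⟨τ, hτ, rfl⟩ j
    exact mul_nonneg hc.le (hτ j)
  · intro τ hτ
    refine ⟨c⁻¹ • τ, fun j => mul_nonneg (inv_nonneg.2 hc.le) (hτ j), ?_⟩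
    simp [smul_smul, hc.ne']

theorem image_sub_posConvexHull {ι : Type*} (A : Set (ι → ℝ)) (e : ι → ℝ) :
    (fun σ => σ - e) '' posConvexHull A = posConvexHull ((fun σ => σ - e) '' A) := by
  have h (B : Set (ι → ℝ)) : (fun σ => σ - e) '' B = B + {-e} := by
    simp [Set.add_singleton, sub_eq_add_neg]
  rw [h, h, posConvexHull_eq, posConvexHull_eq, convexHull_add, convexHull_singleton,
    add_right_comm]

namespace PolyhedraSystem

theorem polyhedron_nonneg (D : PolyhedraSystem.{u}) (J : D.fabric.strata) :
    ∀ σ ∈ D.polyhedron J, ∀ j, 0 ≤ σ j := by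
  obtain ⟨A, hA, h⟩ := D.isChar J
  rw [h]
  refine posConvexHull_nonneg fun σ hσ j => ?_
  obtain ⟨n, hn⟩ := hA σ hσ j
  rw [hn]
  positivity

/-- A polyhedra system with denominator `1`. -/
def IsNewton (D : PolyhedraSystem.{u}) : Prop := D.denom = 1

/-- The contact exponent `δ(D) = max {δ(Δ_J) ; J ∈ 𝓗}`, a maximum over a finite set. -/
noncomputable def contactExponent (D : PolyhedraSystem.{u}) : EReal :=
  ⨆ J : D.fabric.strata, (polyhedronContactExponent (D.polyhedron J) : EReal)

/-- The singular locus `Sing(D) = {J ∈ 𝓗 ; δ(Δ_J) ≥ 1}`. -/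
def Sing (D : PolyhedraSystem.{u}) : Set D.fabric.strata :=
  {J | 1 ≤ polyhedronContactExponent (D.polyhedron J)}

/-- The Newton polyhedra system `N(D) = (F; {d Δ_J}, 1)` associated to `D = (F; {Δ_J}, d)`. -/
noncomputable def newton (D : PolyhedraSystem.{u}) : PolyhedraSystem.{u} where
  fabric := D.fabric
  polyhedron J := (D.denom : ℝ) • D.polyhedron J
  denom := 1
  denom_pos := one_pos
  isChar J := by
    have hd : (0 : ℝ) < D.denom := Nat.cast_pos.2 D.denom_pos
    obtain ⟨A, hA, h⟩ := D.isChar J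
    refine ⟨(D.denom : ℝ) • A, ?_, by rw [h, smul_posConvexHull hd]⟩
    rintro _ ⟨σ, hσ, rfl⟩ j
    obtain ⟨n, hn⟩ := hA σ hσ j
    exact ⟨n, by simp [hn, mul_div_cancel₀ _ hd.ne']⟩
  nonempty J := (D.nonempty J).smul_set
  compat J₁ J₂ h := by
    rw [D.compat J₁ J₂ h]
    ext x
    constructor
    · rintro ⟨_, ⟨σ, hσ, rfl⟩, rfl⟩
      exact ⟨_, ⟨σ, hσ, rfl⟩, rfl⟩
    · rintro ⟨_, ⟨σ, hσ, rfl⟩, rfl⟩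
      exact ⟨_, ⟨σ, hσ, rfl⟩, rfl⟩

/-- The polyhedra system `D/d' = (F; {(1/d') Δ_J}, d d')`. -/
noncomputable def divBy (D : PolyhedraSystem.{u}) (d' : ℕ) (hd' : 0 < d') :
    PolyhedraSystem.{u} where
  fabric := D.fabric
  polyhedron J := (1 / (d' : ℝ)) • D.polyhedron J
  denom := D.denom * d'
  denom_pos := Nat.mul_pos D.denom_pos hd'
  isChar J := by
    have hd : (0 : ℝ) < d' := Nat.cast_pos.2 hd'
    obtain ⟨A, hA, h⟩ := D.isChar J
    refine ⟨(1 / (d' : ℝ)) • A, ?_, by rw [h, smul_posConvexHull (by positivity)]⟩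
    rintro _ ⟨σ, hσ, rfl⟩ j
    obtain ⟨n, hn⟩ := hA σ hσ j
    refine ⟨n, ?_⟩
    simp [hn]
    field_simp
  nonempty J := (D.nonempty J).smul_set
  compat J₁ J₂ h := by
    rw [D.compat J₁ J₂ h]
    ext x
    constructor
    · rintro ⟨_, ⟨σ, hσ, rfl⟩, rfl⟩
      exact ⟨_, ⟨σ, hσ, rfl⟩, rfl⟩
    · rintro ⟨_, ⟨σ, hσ, rfl⟩, rfl⟩
      exact ⟨_, ⟨σ, hσ, rfl⟩, rfl⟩

/-- The polyhedra `Δ⁰_{J'}` of the total transform centered in `J`: `[[λ_{J'}(Δ_K)]]` with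
`K = π_J^#(J')` if `∞ ∈ J'`, and `Δ_{J'}` (with relabelled coordinates) if `∞ ∉ J'`. -/
noncomputable def totalPolyhedron (D : PolyhedraSystem.{u}) (J : D.fabric.strata)
    (J' : D.fabric.blowUpStrata J.1) : Set (J'.1 → ℝ) :=
  if none ∈ (J' : Finset (Option D.fabric.I)) then
    posConvexHull (D.fabric.blowUpLin J J' ''
      D.polyhedron ⟨D.fabric.blowUpMap J J', D.fabric.blowUpMap_mem J'.2⟩)
  else
    D.fabric.blowUpLin J J' ''
      D.polyhedron ⟨D.fabric.blowUpMap J J', D.fabric.blowUpMap_mem J'.2⟩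

/-- The polyhedra `Δ'_{J'} = Δ⁰_{J'} - e_{J',∞}` of the characteristic transform. -/
noncomputable def charPolyhedron (D : PolyhedraSystem.{u}) (J : D.fabric.strata)
    (J' : D.fabric.blowUpStrata J.1) : Set (J'.1 → ℝ) :=
  (fun σ => σ - SupportFabric.eInfty (J' : Finset (Option D.fabric.I))) '' D.totalPolyhedron J J'

theorem totalPolyhedron_eq_aux (D : PolyhedraSystem.{u}) (J : D.fabric.strata)
    (J' : D.fabric.blowUpStrata J.1)
    (A : Set (D.fabric.blowUpMap (J : Finset D.fabric.I) J' → ℝ))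
    (hA : D.polyhedron ⟨D.fabric.blowUpMap J J', D.fabric.blowUpMap_mem J'.2⟩ =
      posConvexHull A) :
    D.totalPolyhedron J J' = posConvexHull (D.fabric.blowUpLin J J' '' A) := by
  unfold totalPolyhedron
  rw [hA]
  split_ifs with hn
  · exact posConvexHull_image_posConvexHull (D.fabric.blowUpLinearMap J J')
      (D.fabric.blowUpLin_nonneg J J') A
  · refine image_posConvexHull (D.fabric.blowUpLinearMap J J') ?_ A
    apply subset_antisymm
    · rintro _ ⟨τ, hτ, rfl⟩
      exact D.fabric.blowUpLin_nonneg J J' τ hτ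
    · intro τ hτ
      have key : ∀ i, i ∈ D.fabric.blowUpMap (J : Finset D.fabric.I) J' →
          some i ∈ (J' : Finset (Option D.fabric.I)) := by
        intro i hi
        rw [SupportFabric.blowUpMap, if_neg hn] at hi
        exact Finset.mem_eraseNone.1 hi
      refine ⟨fun i => τ ⟨some i.1, key i.1 i.2⟩, fun i => hτ _, ?_⟩
      ext ⟨j, hj⟩
      cases j with
      | none => exact absurd hj hn
      | some j => rfl

theorem totalPolyhedron_compat (D : PolyhedraSystem.{u}) (J : D.fabric.strata)
    (J₁ J₂ : D.fabric.blowUpStrata J.1)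
    (h : (J₁ : Finset (Option D.fabric.I)) ⊆ (J₂ : Finset (Option D.fabric.I))) :
    D.totalPolyhedron J J₁ =
      Finset.restrict₂ (π := fun _ => ℝ) h '' D.totalPolyhedron J J₂ := by
  obtain ⟨A, -, hA⟩ :=
    D.isChar ⟨D.fabric.blowUpMap J J₂, D.fabric.blowUpMap_mem J₂.2⟩
  have hA₁ := D.compat ⟨D.fabric.blowUpMap J J₁, D.fabric.blowUpMap_mem J₁.2⟩
    ⟨D.fabric.blowUpMap J J₂, D.fabric.blowUpMap_mem J₂.2⟩ (D.fabric.blowUpMap_mono h)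
  rw [hA, restrict₂_image_posConvexHull] at hA₁
  rw [D.totalPolyhedron_eq_aux J J₁ _ hA₁, D.totalPolyhedron_eq_aux J J₂ _ hA]
  refine Eq.trans ?_ (restrict₂_image_posConvexHull (I := Option D.fabric.I) h _).symm
  rw [Set.image_image, Set.image_image]
  exact congrArg _ (Set.image_congr fun σ _ => D.fabric.blowUpLin_restrict J h σ)

/-- If `J` is singular, then `∑_{j ∈ J} σ(j) ≥ 1` on each `Δ_K` with `K ⊇ J`. -/
theorem one_le_sum_of_mem_sing (D : PolyhedraSystem.{u}) (J K : D.fabric.strata)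
    (hJ : J ∈ D.Sing) (h : (J : Finset D.fabric.I) ⊆ (K : Finset D.fabric.I)) (σ : K.1 → ℝ)
    (hσ : σ ∈ D.polyhedron K) :
    1 ≤ ∑ j : (J : Finset D.fabric.I), σ ⟨j, h j.2⟩ := by
  have h1 : 1 ≤ polyhedronContactExponent (D.polyhedron J) := hJ
  unfold polyhedronContactExponent at h1
  split_ifs at h1 with h0
  · norm_num at h1
  · refine h1.trans (csInf_le ⟨0, ?_⟩ ?_)
    · rintro _ ⟨τ, hτ, rfl⟩
      exact Finset.sum_nonneg fun j _ => D.polyhedron_nonneg J τ hτ j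
    · refine ⟨Finset.restrict₂ (π := fun _ => ℝ) h σ, ?_, rfl⟩
      rw [D.compat J K h]
      exact ⟨σ, hσ, rfl⟩

theorem charPolyhedron_isChar (D : PolyhedraSystem.{u}) (J : D.fabric.strata)
    (hJ : J ∈ D.Sing) (J' : D.fabric.blowUpStrata J.1) :
    IsCharPolyhedron D.denom (D.charPolyhedron J J') := by
  have hd : (0 : ℝ) < D.denom := Nat.cast_pos.2 D.denom_pos
  obtain ⟨A, hA, hAΔ⟩ :=
    D.isChar ⟨D.fabric.blowUpMap J J', D.fabric.blowUpMap_mem J'.2⟩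
  refine ⟨_, ?_, by
    rw [charPolyhedron, D.totalPolyhedron_eq_aux J J' A hAΔ, image_sub_posConvexHull]⟩
  rintro _ ⟨_, ⟨σ, hσ, rfl⟩, rfl⟩ ⟨j, hj⟩
  cases j with
  | some j =>
    obtain ⟨n, hn⟩ := hA σ hσ ⟨j, D.fabric.mem_blowUpMap_of_some hj⟩
    exact ⟨n, by simpa [SupportFabric.blowUpLin, SupportFabric.eInfty] using hn⟩
  | none =>
    have hsum := D.one_le_sum_of_mem_sing J
      ⟨D.fabric.blowUpMap J J', D.fabric.blowUpMap_mem J'.2⟩ hJ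
      (D.fabric.subset_blowUpMap hj) σ (by rw [hAΔ]; exact subset_posConvexHull A hσ)
    choose n hn using hA σ hσ
    have hs : ∑ j : (J : Finset D.fabric.I), σ ⟨j, D.fabric.subset_blowUpMap hj j.2⟩ =
        ((∑ j : (J : Finset D.fabric.I),
          n ⟨j, D.fabric.subset_blowUpMap hj j.2⟩ : ℕ) : ℝ) / D.denom := by
      rw [Nat.cast_sum, Finset.sum_div]
      exact Finset.sum_congr rfl fun j _ => hn _
    rw [hs, le_div_iff₀ hd, one_mul, Nat.cast_le] at hsum
    refine ⟨(∑ j : (J : Finset D.fabric.I), n ⟨j, D.fabric.subset_blowUpMap hj j.2⟩) -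
      D.denom, ?_⟩
    rw [Nat.cast_sub hsum, sub_div, div_self hd.ne', ← hs]
    rfl

theorem charPolyhedron_nonempty (D : PolyhedraSystem.{u}) (J : D.fabric.strata)
    (J' : D.fabric.blowUpStrata J.1) : (D.charPolyhedron J J').Nonempty := by
  refine Set.Nonempty.image _ ?_
  have h := (D.nonempty ⟨D.fabric.blowUpMap J J', D.fabric.blowUpMap_mem J'.2⟩).image
    (D.fabric.blowUpLin J J')
  unfold totalPolyhedron
  split_ifs
  · exact h.mono (subset_posConvexHull _)
  · exact h

theorem charPolyhedron_compat (D : PolyhedraSystem.{u}) (J : D.fabric.strata)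
    (J₁ J₂ : D.fabric.blowUpStrata J.1)
    (h : (J₁ : Finset (Option D.fabric.I)) ⊆ (J₂ : Finset (Option D.fabric.I))) :
    D.charPolyhedron J J₁ =
      Finset.restrict₂ (π := fun _ => ℝ) h '' D.charPolyhedron J J₂ := by
  rw [charPolyhedron, charPolyhedron, D.totalPolyhedron_compat J J₁ J₂ h, Set.image_image,
    Set.image_image]
  refine Set.image_congr fun σ _ => ?_
  rw [← SupportFabric.eInfty_restrict h]
  rfl

/-- The characteristic transform `Λ_J(D)` of `D` centered in `J ∈ Sing(D)`. -/
noncomputable def charTransform (D : PolyhedraSystem.{u}) (J : D.fabric.strata)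
    (hJ : J ∈ D.Sing) : PolyhedraSystem.{u} where
  fabric := D.fabric.blowUp J
  polyhedron := D.charPolyhedron J
  denom := D.denom
  denom_pos := D.denom_pos
  isChar := D.charPolyhedron_isChar J hJ
  nonempty := D.charPolyhedron_nonempty J
  compat := D.charPolyhedron_compat J

/-- The `d`-moderated transform `Θ^d_J(N) = N(Λ_J(N/d))`, for `J ∈ Sing(N/d)`. -/
noncomputable def moderatedTransform (N : PolyhedraSystem.{u}) (d : ℕ) (hd : 0 < d)
    (J : (N.divBy d hd).fabric.strata) (hJ : J ∈ (N.divBy d hd).Sing) : PolyhedraSystem.{u} :=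
  ((N.divBy d hd).charTransform J hJ).newton

/-- `N'` is a `d`-moderated transform of `N`, centered in some `J ∈ Sing(N/d)`. -/
def IsModeratedTransform (d : ℕ) (hd : 0 < d) (N N' : PolyhedraSystem.{u}) : Prop :=
  ∃ (J : (N.divBy d hd).fabric.strata) (hJ : J ∈ (N.divBy d hd).Sing),
    N' = N.moderatedTransform d hd J hJ

end PolyhedraSystem

/-!
The polyhedra of a Newton system are generated by natural vectors on the whole index set `I`,
and a moderated transform acts on each of these vectors separately. It is therefore enough to
resolve families of vectors, each vector with its own threshold, by induction on the size of the
strata.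

Multiplying the vectors by constants makes all thresholds equal to some `d`. Write the vectors as
`m + v s` with a common monomial `m`, initially `0`, and suppose that on each singular stratum some
`v s` has total weight at most `μ`. Adjoining the `v s` with threshold `μ` gives a system in which,
on each singular stratum, some `v s` has total weight exactly `μ`: this is maximal contact, and it
persists under blow-ups. The singular strata through an index `j` are governed by the link of `j`,
whose strata are smaller, so by induction each index can be removed from the singular locus in
turn; in the end the adjoined system is resolved and `μ` has dropped. When `μ = 0`, the monomial `m`
alone decides which strata are singular, and blowing up minimal singular strata decreases the
multiset of its total weights over the singular strata in the Dershowitz–Manna order.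
-/

universe v

namespace SupportFabric

theorem mem_blowUpStrata_iff (F : SupportFabric.{u}) {J : Finset F.I}
    {K' : Finset (Option F.I)} :
    K' ∈ F.blowUpStrata J ↔ F.blowUpMap J K' ∈ F.strata ∧ ¬ J ⊆ K'.eraseNone := by
  constructor
  · refine fun h => ⟨F.blowUpMap_mem h, ?_⟩
    rcases h with ⟨L, -, hJL, rfl⟩ | ⟨K, -, -, A, hA, rfl⟩
    · rwa [Finset.eraseNone_map_some]
    · rw [Finset.eraseNone_insertNone]
      exact fun h => hA.2 fun i hi => by simpa [hi] using h hi
  · rintro ⟨hK, hJ⟩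
    by_cases hn : none ∈ K'
    · rw [blowUpMap, if_pos hn] at hK
      refine Or.inr ⟨_, hK, Finset.subset_union_right, K'.eraseNone ∩ J,
        ⟨Finset.inter_subset_right, fun h => hJ (Finset.subset_inter_iff.1 h).1⟩, ?_⟩
      rw [Finset.union_sdiff_right, Finset.sdiff_union_inter, Finset.insertNone_eraseNone,
        Finset.insert_eq_self.2 hn]
    · rw [blowUpMap, if_neg hn] at hK
      refine Or.inl ⟨_, hK, hJ, ?_⟩
      rw [Finset.map_some_eraseNone, Finset.erase_eq_of_notMem hn]

theorem card_le_card_blowUpMap (F : SupportFabric.{u}) {J : Finset F.I}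
    {K' : Finset (Option F.I)} (hJ : ¬ J ⊆ K'.eraseNone) :
    K'.card ≤ (F.blowUpMap J K').card := by
  by_cases hn : none ∈ K'
  · have hlt : K'.eraseNone.card < (K'.eraseNone ∪ J).card :=
      Finset.card_lt_card ⟨Finset.subset_union_left,
        fun h => hJ (Finset.subset_union_right.trans h)⟩
    rw [Finset.card_eraseNone_of_mem hn] at hlt
    rw [blowUpMap, if_pos hn]
    exact Nat.le_of_pred_lt hlt
  · rw [blowUpMap, if_neg hn, Finset.card_eraseNone_of_not_mem hn]

/-- Every stratum has at most `n` elements; this bounds the dimension in the induction. -/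
def StrataCardLE (F : SupportFabric.{u}) (n : ℕ) : Prop :=
  ∀ K ∈ F.strata, K.card ≤ n

theorem StrataCardLE.blowUp {F : SupportFabric.{u}} {n : ℕ} (hF : F.StrataCardLE n)
    (J : Finset F.I) : (F.blowUp J).StrataCardLE n := fun K' hK' => by
  obtain ⟨hK, hJ⟩ := F.mem_blowUpStrata_iff.1 hK'
  exact (F.card_le_card_blowUpMap hJ).trans (hF _ hK)

/-- The link of the index `j`: the strata `K` avoiding `j` such that `K ∪ {j}` is a stratum. It
keeps the index set, so that weights on a fabric are weights on the link. -/
abbrev link (F : SupportFabric.{u}) (j : F.I) : SupportFabric.{u} where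
  I := F.I
  strata := {K | j ∉ K ∧ insert j K ∈ F.strata}
  isOpen _ hK _ hLK :=
    ⟨fun hj => hK.1 (hLK hj), F.isOpen _ hK.2 _ (Finset.insert_subset_insert j hLK)⟩

theorem StrataCardLE.link {F : SupportFabric.{u}} {n : ℕ} (hF : F.StrataCardLE (n + 1))
    (j : F.I) : (F.link j).StrataCardLE n := fun _ ⟨hj, hK⟩ =>
  Nat.le_of_succ_le_succ ((Finset.card_insert_of_notMem hj).symm.trans_le (hF _ hK))

theorem blowUpMap_insert (F : SupportFabric.{u}) (j : F.I) (J : Finset F.I)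
    (K' : Finset (Option F.I)) :
    F.blowUpMap (insert j J) (insert (some j) K') = insert j (F.blowUpMap J K') := by
  unfold blowUpMap
  by_cases hn : none ∈ K' <;> ext i <;> simp [hn, or_assoc]

theorem mem_link_blowUp_iff (F : SupportFabric.{u}) {j : F.I} {J : Finset F.I} (hj : j ∉ J)
    (K' : Finset (Option F.I)) :
    some j ∉ K' ∧ insert (some j) K' ∈ F.blowUpStrata (insert j J) ↔
      K' ∈ (F.link j).blowUpStrata J := by
  have herase : (insert (some j) K').eraseNone = insert j K'.eraseNone := by
    ext; simp
  have hmem : j ∈ (F.link j).blowUpMap J K' ↔ some j ∈ K' := by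
    unfold blowUpMap; split_ifs <;> simp [hj]
  rw [mem_blowUpStrata_iff, mem_blowUpStrata_iff, F.blowUpMap_insert, herase,
    Finset.insert_subset_insert_iff hj, ← and_assoc, ← hmem]
  rfl

end SupportFabric

section BlowUpWeight

variable {ι : Type*} {d : ℕ} {J : Finset ι} {w w' : ι → ℕ}

/-- The transform of a weight vector under a blow-up centered in `J` with threshold `d`. The
subtraction is truncated; it is exact when `J` is singular. -/
def blowUpWeight (d : ℕ) (J : Finset ι) (w : ι → ℕ) : Option ι → ℕ
  | none => (∑ j ∈ J, w j) - d
  | some i => w i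

theorem blowUpWeight_mono (hw : w ≤ w') : blowUpWeight d J w ≤ blowUpWeight d J w'
  | none => Nat.sub_le_sub_right (Finset.sum_le_sum fun j _ => hw j) d
  | some i => hw i

theorem sum_blowUpWeight [DecidableEq ι] (d : ℕ) (J : Finset ι) (w : ι → ℕ)
    (K' : Finset (Option ι)) :
    ∑ o ∈ K', blowUpWeight d J w o =
      (if none ∈ K' then (∑ j ∈ J, w j) - d else 0) + ∑ i ∈ K'.eraseNone, w i := by
  split_ifs with hn
  · have hK' : K' = K'.eraseNone.insertNone := by
      rw [Finset.insertNone_eraseNone, Finset.insert_eq_self.2 hn]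
    conv_lhs => rw [hK', Finset.sum_insertNone]
    rfl
  · have hK' : K' = K'.eraseNone.map Function.Embedding.some := by
      rw [Finset.map_some_eraseNone, Finset.erase_eq_of_notMem hn]
    conv_lhs => rw [hK', Finset.sum_map]
    exact (zero_add _).symm

end BlowUpWeight

namespace SupportFabric

variable (F : SupportFabric.{u}) {d : ℕ} {J : Finset F.I} {K' : Finset (Option F.I)}
  {w m : F.I → ℕ}

theorem blowUpWeight_congr (h : ∀ i ∈ F.blowUpMap J K', w i = m i) :
    ∀ o ∈ K', blowUpWeight d J w o = blowUpWeight d J m o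
  | none, ho => congrArg (· - d) (Finset.sum_congr rfl fun j hj => h j (F.subset_blowUpMap ho hj))
  | some i, ho => h i (F.mem_blowUpMap_of_some ho)

theorem sum_blowUpWeight_le (h : none ∈ K' → ∑ j ∈ J, w j ≤ d) :
    ∑ o ∈ K', blowUpWeight d J w o ≤ ∑ i ∈ F.blowUpMap J K', w i := by
  rw [sum_blowUpWeight]
  by_cases hn : none ∈ K'
  · rw [if_pos hn, Nat.sub_eq_zero_of_le (h hn), zero_add, blowUpMap, if_pos hn]
    exact Finset.sum_le_sum_of_subset Finset.subset_union_left
  · rw [if_neg hn, zero_add, blowUpMap, if_neg hn]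

theorem sum_blowUpWeight_lt (hJ : d ≤ ∑ j ∈ J, w j) (hmin : ∀ A ⊂ J, ∑ j ∈ A, w j < d)
    (hJK' : ¬ J ⊆ K'.eraseNone) (hn : none ∈ K') :
    ∑ o ∈ K', blowUpWeight d J w o < ∑ i ∈ F.blowUpMap J K', w i := by
  have hinter : ∑ i ∈ K'.eraseNone ∩ J, w i < d :=
    hmin _ ⟨Finset.inter_subset_right, fun h => hJK' (Finset.subset_inter_iff.1 h).1⟩
  have hunion := Finset.sum_union_inter (s₁ := K'.eraseNone) (s₂ := J) (f := w)
  rw [sum_blowUpWeight, if_pos hn, blowUpMap, if_pos hn]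
  omega

end SupportFabric

/-- A support fabric with a family of weight vectors on its index set; the restrictions of the
vectors to a stratum `J` stand for generators of `Δ_J`. -/
structure WeightedFabric (α : Type v) where
  fabric : SupportFabric.{u}
  weight : α → fabric.I → ℕ

namespace WeightedFabric

variable {α : Type v} {β : Type*} {d : α → ℕ} {P Q R : WeightedFabric.{u} α}

/-- The strata on which every weight vector `s` has total weight at least its threshold `d s`. -/
def singular (P : WeightedFabric.{u} α) (d : α → ℕ) : Set (Finset P.fabric.I) :=
  {K | K ∈ P.fabric.strata ∧ ∀ s, d s ≤ ∑ i ∈ K, P.weight s i}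

/-- The transform with center `J` and thresholds `d`, meant for a singular `J`. -/
abbrev blowUp (P : WeightedFabric.{u} α) (d : α → ℕ) (J : Finset P.fabric.I) :
    WeightedFabric.{u} α where
  fabric := P.fabric.blowUp J
  weight s := blowUpWeight (d s) J (P.weight s)

/-- Reindexing of the family of weight vectors. -/
abbrev comap (P : WeightedFabric.{u} α) (f : β → α) : WeightedFabric.{u} β :=
  ⟨P.fabric, P.weight ∘ f⟩

/-- The link of the index `j`, with the same weight vectors. -/
abbrev link (P : WeightedFabric.{u} α) (j : P.fabric.I) : WeightedFabric.{u} α :=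
  ⟨P.fabric.link j, P.weight⟩

/-- Multiplication of the weight vector `s` by `c s`, used to make all thresholds equal. -/
abbrev scale (P : WeightedFabric.{u} α) (c : α → ℕ) : WeightedFabric.{u} α :=
  ⟨P.fabric, fun s i => c s * P.weight s i⟩

theorem singular_mono {K L : Finset P.fabric.I} (hK : K ∈ P.singular d)
    (hL : L ∈ P.fabric.strata) (hKL : K ⊆ L) : L ∈ P.singular d :=
  ⟨hL, fun s => (hK.2 s).trans (Finset.sum_le_sum_of_subset hKL)⟩

theorem finite_singular : (P.singular d).Finite :=
  Set.toFinite _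

theorem not_subset_eraseNone {J : Finset P.fabric.I} {K' : Finset (Option P.fabric.I)}
    (hK' : K' ∈ (P.blowUp d J).singular d) : ¬ J ⊆ K'.eraseNone :=
  (P.fabric.mem_blowUpStrata_iff.1 hK'.1).2

theorem blowUpMap_mem_singular {J : Finset P.fabric.I} (hJ : J ∈ P.singular d)
    {K' : Finset (Option P.fabric.I)} (hK' : K' ∈ (P.blowUp d J).singular d) :
    P.fabric.blowUpMap J K' ∈ P.singular d := by
  have hstratum := P.fabric.blowUpMap_mem hK'.1
  by_cases hn : none ∈ K'
  · exact singular_mono hJ hstratum (P.fabric.subset_blowUpMap hn)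
  · refine ⟨hstratum, fun s => (hK'.2 s).trans ?_⟩
    exact P.fabric.sum_blowUpWeight_le fun h => absurd h hn

/-- `Reaches d P Q e` says that `Q` is obtained from `P` by finitely many blow-ups with singular
centers, where `e` carries the indices of `P` to those of `Q`. -/
inductive Reaches (d : α → ℕ) (P : WeightedFabric.{u} α) :
    (Q : WeightedFabric.{u} α) → (P.fabric.I ↪ Q.fabric.I) → Prop
  | refl : Reaches d P P (.refl _)
  | blowUp {Q : WeightedFabric.{u} α} {e : P.fabric.I ↪ Q.fabric.I} {J : Finset Q.fabric.I} :
      Reaches d P Q e → J ∈ Q.singular d → Reaches d P (Q.blowUp d J) (e.trans .some)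

/-- Some finite sequence of blow-ups with singular centers makes the singular locus empty. -/
def Resolvable (d : α → ℕ) (P : WeightedFabric.{u} α) : Prop :=
  ∃ Q e, Reaches d P Q e ∧ Q.singular d = ∅

namespace Reaches

variable {e : P.fabric.I ↪ Q.fabric.I}

theorem trans {e' : Q.fabric.I ↪ R.fabric.I} (h : Reaches d P Q e) (h' : Reaches d Q R e') :
    Reaches d P R (e.trans e') := by
  induction h' with
  | refl => exact h
  | blowUp _ hJ ih => exact ih.blowUp hJ

theorem weight_apply (h : Reaches d P Q e) (s : α) (i : P.fabric.I) :
    Q.weight s (e i) = P.weight s i := by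
  induction h with
  | refl => rfl
  | blowUp _ _ ih => exact ih

theorem strataCardLE (h : Reaches d P Q e) {n : ℕ} (hP : P.fabric.StrataCardLE n) :
    Q.fabric.StrataCardLE n := by
  induction h with
  | refl => exact hP
  | blowUp _ _ ih => exact ih.blowUp _

theorem comap (h : Reaches d P Q e) (f : β → α) : Reaches (d ∘ f) (P.comap f) (Q.comap f) e := by
  induction h with
  | refl => exact refl
  | blowUp _ hJ ih => exact ih.blowUp ⟨hJ.1, fun s => hJ.2 (f s)⟩

end Reaches

theorem Resolvable.of_reaches {e : P.fabric.I ↪ Q.fabric.I} (hQ : Resolvable d Q)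
    (h : Reaches d P Q e) : Resolvable d P := by
  obtain ⟨R, _, hR, hempty⟩ := hQ
  exact ⟨R, _, h.trans hR, hempty⟩

section Scale

variable {c : α → ℕ}

theorem singular_scale (hc : ∀ s, 0 < c s) : (P.scale c).singular (c * d) = P.singular d := by
  ext K
  refine and_congr_right fun _ => forall_congr' fun s => ?_
  rw [Pi.mul_apply, ← Finset.mul_sum]
  exact Nat.mul_le_mul_left_iff (hc s)

theorem scale_blowUp (J : Finset P.fabric.I) :
    (P.scale c).blowUp (c * d) J = (P.blowUp d J).scale c := by
  refine congrArg (WeightedFabric.mk _) (funext₂ fun s o => ?_)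
  cases o with
  | none => exact (congrArg (· - _) (Finset.mul_sum _ _ _).symm).trans (Nat.mul_sub _ _ _).symm
  | some i => rfl

theorem exists_reaches_of_scale (hc : ∀ s, 0 < c s) {e : (P.scale c).fabric.I ↪ Q.fabric.I}
    (h : Reaches (c * d) (P.scale c) Q e) : ∃ P' e', Reaches d P P' e' ∧ P'.scale c = Q := by
  induction h with
  | refl => exact ⟨P, _, .refl, rfl⟩
  | blowUp _ hJ ih =>
    obtain ⟨P', e', hP', rfl⟩ := ih
    rw [singular_scale hc] at hJ
    exact ⟨_, _, hP'.blowUp hJ, (scale_blowUp _).symm⟩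

theorem Resolvable.of_scale (hc : ∀ s, 0 < c s) (h : Resolvable (c * d) (P.scale c)) :
    Resolvable d P := by
  obtain ⟨Q, e, hQ, hempty⟩ := h
  obtain ⟨P', e', hP', rfl⟩ := exists_reaches_of_scale hc hQ
  exact ⟨P', e', hP', (singular_scale hc).symm.trans hempty⟩

end Scale

section Link

theorem mk_congr {I : Type u} [Fintype I] [DecidableEq I] {S T : Set (Finset I)} {hS hT}
    {w w' : α → I → ℕ} (hST : S = T) (hw : w = w') :
    WeightedFabric.mk ⟨I, S, hS⟩ w = ⟨⟨I, T, hT⟩, w'⟩ := by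
  subst hST hw; rfl

/-- The link of `j` with the weight vectors whose value `v s` at `j` is below the threshold: these
are the only ones that constrain the singular strata through `j`. -/
abbrev linkBelow (P : WeightedFabric.{u} α) (j : P.fabric.I) (d v : α → ℕ) :
    WeightedFabric.{u} {s // v s < d s} :=
  (P.comap Subtype.val).link j

/-- What is left of the thresholds on the link of `j` once the values `v` at `j` are removed. -/
def residual (d v : α → ℕ) (s : {s // v s < d s}) : ℕ :=
  d s - v s

variable {j : P.fabric.I} {v : α → ℕ}

theorem insert_mem_singular_iff (hv : ∀ s, P.weight s j = v s) {K : Finset P.fabric.I}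
    (hj : j ∉ K) :
    insert j K ∈ P.singular d ↔ K ∈ (P.linkBelow j d v).singular (residual d v) := by
  constructor
  · refine fun hK => ⟨⟨hj, hK.1⟩, fun s => ?_⟩
    have hs := hK.2 s
    rw [Finset.sum_insert hj, hv] at hs
    exact Nat.sub_le_iff_le_add'.2 hs
  · refine fun hK => ⟨hK.1.2, fun s => ?_⟩
    rw [Finset.sum_insert hj, hv]
    by_cases hs : v s < d s
    · exact Nat.sub_le_iff_le_add'.1 (hK.2 ⟨s, hs⟩)
    · exact (not_lt.1 hs).trans (Nat.le_add_right _ _)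

theorem linkBelow_blowUp {J : Finset P.fabric.I} (hv : ∀ s, P.weight s j = v s) (hj : j ∉ J) :
    (P.blowUp d (insert j J)).linkBelow (some j) d v =
      (P.linkBelow j d v).blowUp (residual d v) J := by
  refine mk_congr (Set.ext (P.fabric.mem_link_blowUp_iff hj)) (funext₂ fun s o => ?_)
  cases o with
  | none =>
    have hsum : ∑ i ∈ insert j J, P.weight s i = v s + ∑ i ∈ J, P.weight s i := by
      rw [Finset.sum_insert hj, hv]
    have hsub : d s - (d s - v s) = v s := Nat.sub_sub_self s.2.le
    change (∑ i ∈ insert j J, P.weight s i) - d s = (∑ i ∈ J, P.weight s i) - (d s - v s)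
    omega
  | some i => rfl

theorem exists_reaches_of_linkBelow (hv : ∀ s, P.weight s j = v s)
    {Q : WeightedFabric.{u} {s // v s < d s}}
    {e : (P.linkBelow j d v).fabric.I ↪ Q.fabric.I}
    (h : Reaches (residual d v) (P.linkBelow j d v) Q e) :
    ∃ P' e', Reaches d P P' e' ∧ P'.linkBelow (e' j) d v = Q := by
  induction h with
  | refl => exact ⟨P, _, .refl, rfl⟩
  | blowUp _ hJ ih =>
    obtain ⟨P', e', hP', rfl⟩ := ih
    have hv' s : P'.weight s (e' j) = v s := (hP'.weight_apply s j).trans (hv s)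
    exact ⟨_, _, hP'.blowUp ((insert_mem_singular_iff hv' hJ.1.1).2 hJ),
      linkBelow_blowUp hv' hJ.1.1⟩

theorem exists_reaches_forall_notMem_of_linkBelow (hv : ∀ s, P.weight s j = v s)
    (h : Resolvable (residual d v) (P.linkBelow j d v)) :
    ∃ P' e, Reaches d P P' e ∧ ∀ K ∈ P'.singular d, e j ∉ K := by
  obtain ⟨Q, _, hQ, hempty⟩ := h
  obtain ⟨P', e, hP', rfl⟩ := exists_reaches_of_linkBelow hv hQ
  refine ⟨P', e, hP', fun K hK hj =>
    Set.eq_empty_iff_forall_notMem.1 hempty (K.erase (e j)) ?_⟩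
  rw [← Finset.insert_erase hj] at hK
  exact (insert_mem_singular_iff (fun s => (hP'.weight_apply s j).trans (hv s))
    (Finset.notMem_erase _ _)).1 hK

theorem exists_reaches_forall_notMem_of_le (hj : ∀ s, d s ≤ P.weight s j) :
    ∃ P' e, Reaches d P P' e ∧ ∀ K ∈ P'.singular d, e j ∉ K := by
  by_cases hstratum : {j} ∈ P.fabric.strata
  · have hsing : {j} ∈ P.singular d := ⟨hstratum, fun s => by simpa using hj s⟩
    refine ⟨_, _, Reaches.refl.blowUp hsing, fun K' hK' hjK' => not_subset_eraseNone hK' ?_⟩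
    exact Finset.singleton_subset_iff.2 (Finset.mem_eraseNone.2 hjK')
  · refine ⟨P, _, .refl, fun K hK hjK => hstratum (P.fabric.isOpen K hK.1 _ ?_)⟩
    exact Finset.singleton_subset_iff.2 hjK

end Link

section Contact

/-- Resolvability of all systems whose strata have at most `n` elements, the statement proved by
induction on `n`. The thresholds are bounded because they are to have a common multiple. -/
def ResolvableInCard (n : ℕ) : Prop :=
  ∀ {α : Type v} [Nonempty α] (d : α → ℕ) (P : WeightedFabric.{u} α), (∀ s, 0 < d s) →
    BddAbove (Set.range d) → P.fabric.StrataCardLE n → Resolvable d P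

theorem ResolvableInCard.exists_reaches_forall_notMem {n : ℕ}
    (hn : ResolvableInCard.{u, v} n) (hd : BddAbove (Set.range d))
    (hP : P.fabric.StrataCardLE (n + 1)) (j : P.fabric.I) :
    ∃ P' e, Reaches d P P' e ∧ ∀ K ∈ P'.singular d, e j ∉ K := by
  obtain hempty | _ := isEmpty_or_nonempty {s // P.weight s j < d s}
  · exact exists_reaches_forall_notMem_of_le fun s => not_lt.1 fun hs => hempty.false ⟨s, hs⟩
  · refine exists_reaches_forall_notMem_of_linkBelow (fun s => rfl)
      (hn _ _ (fun s => Nat.sub_pos_of_lt s.2) ?_ (hP.link j))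
    obtain ⟨b, hb⟩ := hd
    refine ⟨b, ?_⟩
    rintro _ ⟨s, rfl⟩
    exact (Nat.sub_le _ _).trans (hb ⟨s, rfl⟩)

/-- Maximal contact, realised by the weight vectors in `p` and the coordinates in `T`: on each
singular stratum some vector in `p` has total weight at most its threshold and is supported
in `T`. -/
def MaximalContact (d : α → ℕ) (P : WeightedFabric.{u} α) (p : Set α) (T : Finset P.fabric.I) :
    Prop :=
  ∀ K ∈ P.singular d, ∃ s ∈ p, ∑ i ∈ K, P.weight s i ≤ d s ∧ ∀ i ∈ K, i ∉ T → P.weight s i = 0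

namespace MaximalContact

variable {p : Set α} {T : Finset P.fabric.I}

theorem blowUp (h : MaximalContact d P p T) {J : Finset P.fabric.I} (hJ : J ∈ P.singular d) :
    MaximalContact d (P.blowUp d J) p (T.map .some) := fun K' hK' => by
  obtain ⟨s, hs, hle, hzero⟩ := h _ (blowUpMap_mem_singular hJ hK')
  have hJle (hn : none ∈ K') : ∑ j ∈ J, P.weight s j ≤ d s :=
    (Finset.sum_le_sum_of_subset (P.fabric.subset_blowUpMap hn)).trans hle
  refine ⟨s, hs, (P.fabric.sum_blowUpWeight_le hJle).trans hle, fun o ho hoT => ?_⟩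
  cases o with
  | none => exact Nat.sub_eq_zero_of_le (hJle ho)
  | some i =>
    exact hzero i (P.fabric.mem_blowUpMap_of_some ho)
      fun hi => hoT (Finset.mem_map_of_mem Function.Embedding.some hi)

theorem of_reaches {e : P.fabric.I ↪ Q.fabric.I} (h : MaximalContact d P p T)
    (hQ : Reaches d P Q e) : MaximalContact d Q p (T.map e) := by
  induction hQ with
  | refl => rwa [Finset.map_refl]
  | blowUp _ hJ ih => exact Finset.map_map _ _ T ▸ ih.blowUp hJ

theorem erase (h : MaximalContact d P p T) {j : P.fabric.I}
    (hj : ∀ K ∈ P.singular d, j ∉ K) : MaximalContact d P p (T.erase j) := fun K hK => by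
  obtain ⟨s, hs, hle, hzero⟩ := h K hK
  refine ⟨s, hs, hle, fun i hi hiT => hzero i hi fun hi' => hiT (Finset.mem_erase.2 ⟨?_, hi'⟩)⟩
  rintro rfl
  exact hj K hK hi

theorem singular_eq_empty (h : MaximalContact d P p ∅) (hd : ∀ s, 0 < d s) :
    P.singular d = ∅ := by
  refine Set.eq_empty_of_forall_notMem fun K hK => ?_
  obtain ⟨s, -, -, hzero⟩ := h K hK
  have hsum : ∑ i ∈ K, P.weight s i = 0 :=
    Finset.sum_eq_zero fun i hi => hzero i hi (Finset.notMem_empty i)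
  exact (hd s).not_ge (hsum ▸ hK.2 s)

theorem resolvable (h : MaximalContact d P p T) {n : ℕ} (hn : ResolvableInCard.{u, v} n)
    (hd : ∀ s, 0 < d s) (hbdd : BddAbove (Set.range d)) (hP : P.fabric.StrataCardLE (n + 1)) :
    Resolvable d P := by
  induction hT : T.card generalizing P with
  | zero =>
    rw [Finset.card_eq_zero] at hT
    subst hT
    exact ⟨P, _, .refl, h.singular_eq_empty hd⟩
  | succ k ih =>
    obtain ⟨j, hj⟩ : T.Nonempty := Finset.card_pos.1 (hT ▸ Nat.succ_pos k)
    obtain ⟨Q, e, hQ, hnot⟩ := hn.exists_reaches_forall_notMem hbdd hP j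
    refine Resolvable.of_reaches (ih ((h.of_reaches hQ).erase hnot) (hQ.strataCardLE hP) ?_) hQ
    rw [Finset.card_erase_of_mem (Finset.mem_map_of_mem e hj), Finset.card_map, hT,
      Nat.add_sub_cancel]

end MaximalContact

end Contact

end WeightedFabric

section DershowitzManna

open Classical in
theorem filter_none_notMem_eq_map {ι : Type*} {J : Finset ι} {S : Finset (Finset ι)}
    {S' : Finset (Finset (Option ι))} (hS' : ∀ L, L.map .some ∈ S' ↔ L ∈ S ∧ ¬ J ⊆ L) :
    S'.filter (none ∉ ·) =
      (S.filter (¬ J ⊆ ·)).map (Finset.mapEmbedding .some).toEmbedding := by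
  ext K'
  simp only [Finset.mem_filter, Finset.mem_map, ← hS']
  constructor
  · rintro ⟨hK', hn⟩
    have hmap : K'.eraseNone.map .some = K' := by
      rw [Finset.map_some_eraseNone, Finset.erase_eq_of_notMem hn]
    exact ⟨K'.eraseNone, hmap.symm ▸ hK', hmap⟩
  · rintro ⟨L, hL, rfl⟩
    exact ⟨hL, by simp⟩

theorem isDershowitzMannaLT_map_sum {ι : Type*} {J : Finset ι} {S : Finset (Finset ι)}
    {S' : Finset (Finset (Option ι))} {m : ι → ℕ} {m' : Option ι → ℕ}
    (hS' : ∀ L, L.map .some ∈ S' ↔ L ∈ S ∧ ¬ J ⊆ L) (hm' : ∀ i, m' (some i) = m i)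
    (hJ : J ∈ S)
    (hlt : ∀ K' ∈ S', none ∈ K' → ∃ K ∈ S, J ⊆ K ∧ ∑ o ∈ K', m' o < ∑ i ∈ K, m i) :
    Multiset.IsDershowitzMannaLT (S'.val.map fun K' => ∑ o ∈ K', m' o)
      (S.val.map fun K => ∑ i ∈ K, m i) := by
  classical
  have hkeep : (S'.filter (none ∉ ·)).val.map (fun K' => ∑ o ∈ K', m' o) =
      (S.filter (¬ J ⊆ ·)).val.map fun K => ∑ i ∈ K, m i := by
    rw [filter_none_notMem_eq_map hS', Finset.map_val, Multiset.map_map]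
    refine Multiset.map_congr rfl fun L _ => ?_
    exact (Finset.sum_map L _ _).trans (Finset.sum_congr rfl fun i _ => hm' i)
  refine ⟨(S.filter (¬ J ⊆ ·)).val.map fun K => ∑ i ∈ K, m i,
    (S'.filter (none ∈ ·)).val.map fun K' => ∑ o ∈ K', m' o,
    (S.filter (J ⊆ ·)).val.map fun K => ∑ i ∈ K, m i, ?_, ?_, ?_, ?_⟩
  · refine Multiset.map_eq_zero.not.2 fun h => ?_
    exact Finset.notMem_empty J (Finset.val_eq_zero.1 h ▸ Finset.mem_filter.2 ⟨hJ, subset_rfl⟩)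
  · rw [← hkeep, ← Multiset.map_add, Finset.filter_val, Finset.filter_val, add_comm,
      Multiset.filter_add_not]
  · rw [← Multiset.map_add, Finset.filter_val, Finset.filter_val, add_comm,
      Multiset.filter_add_not]
  · intro y hy
    obtain ⟨K', hK', rfl⟩ := Multiset.mem_map.1 hy
    obtain ⟨hK'S, hn⟩ := Finset.mem_filter.1 hK'
    obtain ⟨K, hKS, hJK, hKlt⟩ := hlt K' hK'S hn
    exact ⟨_, Multiset.mem_map_of_mem _ (Finset.mem_filter.2 ⟨hKS, hJK⟩), hKlt⟩

end DershowitzManna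

namespace WeightedFabric

section Monomial

variable {α : Type v}

theorem map_some_mem_singular_blowUp_iff {d : α → ℕ} {P : WeightedFabric.{u} α}
    {J L : Finset P.fabric.I} :
    L.map .some ∈ (P.blowUp d J).singular d ↔ L ∈ P.singular d ∧ ¬ J ⊆ L := by
  change L.map .some ∈ P.fabric.blowUpStrata J ∧ _ ↔ _
  rw [SupportFabric.mem_blowUpStrata_iff, P.fabric.blowUpMap_map_some,
    Finset.eraseNone_map_some, and_right_comm]
  refine and_congr_left fun _ => and_congr_right fun _ => forall_congr' fun s => ?_
  exact iff_of_eq (congrArg (d s ≤ ·) (Finset.sum_map L _ _))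

/-- The multiset of the total weights of `m` over the singular strata; it decreases in the
Dershowitz–Manna order when a system with monomial `m` is blown up suitably. -/
noncomputable def singularWeights (P : WeightedFabric.{u} α) (d : α → ℕ) (m : P.fabric.I → ℕ) :
    Multiset ℕ :=
  (P.finite_singular (d := d)).toFinset.val.map fun K => ∑ i ∈ K, m i

/-- The monomial case: the polyhedron of each singular stratum has the single vertex `m`. -/
def IsMonomial (d : α → ℕ) (P : WeightedFabric.{u} α) (m : P.fabric.I → ℕ) : Prop :=
  (∀ s, m ≤ P.weight s) ∧ ∀ K ∈ P.singular d, ∃ s, ∀ i ∈ K, P.weight s i = m i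

namespace IsMonomial

variable {d : ℕ} {P : WeightedFabric.{u} α} {m : P.fabric.I → ℕ}

theorem mem_singular_iff (h : IsMonomial (fun _ => d) P m) {K : Finset P.fabric.I} :
    K ∈ P.singular (fun _ => d) ↔ K ∈ P.fabric.strata ∧ d ≤ ∑ i ∈ K, m i := by
  refine ⟨fun hK => ⟨hK.1, ?_⟩, fun hK => ⟨hK.1, fun s =>
    hK.2.trans (Finset.sum_le_sum fun i _ => h.1 s i)⟩⟩
  obtain ⟨s, hs⟩ := h.2 K hK
  exact (hK.2 s).trans_eq (Finset.sum_congr rfl hs)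

theorem blowUp (h : IsMonomial (fun _ => d) P m) {J : Finset P.fabric.I}
    (hJ : J ∈ P.singular fun _ => d) :
    IsMonomial (fun _ => d) (P.blowUp (fun _ => d) J) (blowUpWeight d J m) := by
  refine ⟨fun s => blowUpWeight_mono (h.1 s), fun K' hK' => ?_⟩
  obtain ⟨s, hs⟩ := h.2 _ (blowUpMap_mem_singular hJ hK')
  exact ⟨s, P.fabric.blowUpWeight_congr hs⟩

theorem singularWeights_blowUp_lt (h : IsMonomial (fun _ => d) P m) {J : Finset P.fabric.I}
    (hJ : Minimal (· ∈ P.singular fun _ => d) J) :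
    Multiset.IsDershowitzMannaLT
      ((P.blowUp (fun _ => d) J).singularWeights (fun _ => d) (blowUpWeight d J m))
      (P.singularWeights (fun _ => d) m) := by
  have hsum : d ≤ ∑ i ∈ J, m i := (h.mem_singular_iff.1 hJ.prop).2
  have hmin (A : Finset P.fabric.I) (hA : A ⊂ J) : ∑ i ∈ A, m i < d :=
    not_le.1 fun hle => hJ.not_prop_of_lt hA
      (h.mem_singular_iff.2 ⟨P.fabric.isOpen J hJ.prop.1 A hA.subset, hle⟩)
  have hmem {K'} := ((P.blowUp (fun _ => d) J).finite_singular (d := fun _ => d)).mem_toFinset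
    (a := K')
  exact isDershowitzMannaLT_map_sum
    (fun L => hmem.trans (map_some_mem_singular_blowUp_iff.trans
      (and_congr_left' P.finite_singular.mem_toFinset.symm)))
    (fun i => rfl) (P.finite_singular.mem_toFinset.2 hJ.prop) fun K' hK' hn =>
      ⟨P.fabric.blowUpMap J K',
        P.finite_singular.mem_toFinset.2 (blowUpMap_mem_singular hJ.prop (hmem.1 hK')),
        P.fabric.subset_blowUpMap hn,
        P.fabric.sum_blowUpWeight_lt hsum hmin (not_subset_eraseNone (hmem.1 hK')) hn⟩

theorem resolvable (h : IsMonomial (fun _ => d) P m) : Resolvable (fun _ => d) P := by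
  induction hM : P.singularWeights (fun _ => d) m using
    (Multiset.wellFounded_isDershowitzMannaLT (α := ℕ)).induction generalizing P with
  | _ M ih =>
    subst hM
    obtain hempty | hne := (P.singular fun _ => d).eq_empty_or_nonempty
    · exact ⟨P, _, .refl, hempty⟩
    · obtain ⟨J, hJ⟩ := P.finite_singular.exists_minimal hne
      exact (ih _ (h.singularWeights_blowUp_lt hJ) (h.blowUp hJ.prop) rfl).of_reaches
        (.blowUp .refl hJ.prop)

end IsMonomial

end Monomial

section MonomialPart

variable {α : Type v} {d μ : ℕ} {R Q : WeightedFabric.{u} (α ⊕ α)}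

/-- A common monomial factor: the vectors `inr s` are those of the system to be resolved, and
subtracting the same `m` from all of them gives the vectors `inl s`. -/
def HasMonomialPart (R : WeightedFabric.{u} (α ⊕ α)) (m : R.fabric.I → ℕ) : Prop :=
  ∀ s i, R.weight (.inr s) i = m i + R.weight (.inl s) i

/-- The threshold `μ` for the vectors `inl s` and the threshold `d` for the vectors `inr s`. -/
abbrev sumThreshold (α : Type v) (μ d : ℕ) : α ⊕ α → ℕ :=
  Sum.elim (fun _ => μ) fun _ => d

theorem HasMonomialPart.blowUp {m : R.fabric.I → ℕ} (h : R.HasMonomialPart m)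
    {J : Finset R.fabric.I} (hJ : J ∈ R.singular (sumThreshold α μ d))
    (hμ : ∃ s, ∑ i ∈ J, R.weight (.inl s) i ≤ μ) :
    (R.blowUp (sumThreshold α μ d) J).HasMonomialPart
      fun o => o.elim ((∑ i ∈ J, m i) + μ - d) m := by
  have hsum s : ∑ i ∈ J, R.weight (.inr s) i =
      (∑ i ∈ J, m i) + ∑ i ∈ J, R.weight (.inl s) i := by
    rw [← Finset.sum_add_distrib]
    exact Finset.sum_congr rfl fun i _ => h s i
  rintro s (_ | i)
  · obtain ⟨s₀, hs₀⟩ := hμ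
    have hd : d ≤ (∑ i ∈ J, m i) + μ :=
      (hJ.2 (.inr s₀)).trans ((hsum s₀).trans_le (Nat.add_le_add_left hs₀ _))
    have hμs : μ ≤ ∑ i ∈ J, R.weight (.inl s) i := hJ.2 (.inl s)
    change (∑ i ∈ J, R.weight (.inr s) i) - d =
      (∑ i ∈ J, m i) + μ - d + ((∑ i ∈ J, R.weight (.inl s) i) - μ)
    rw [hsum]
    omega
  · exact h s i

theorem HasMonomialPart.of_reaches {m : R.fabric.I → ℕ} {T : Finset R.fabric.I}
    (h : R.HasMonomialPart m)
    (hT : MaximalContact (sumThreshold α μ d) R (Set.range Sum.inl) T)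
    {e : R.fabric.I ↪ Q.fabric.I} (hQ : Reaches (sumThreshold α μ d) R Q e) :
    ∃ m', Q.HasMonomialPart m' := by
  induction hQ with
  | refl => exact ⟨m, h⟩
  | blowUp hQ hJ ih =>
    obtain ⟨m', hm'⟩ := ih
    obtain ⟨_, ⟨s, rfl⟩, hle, -⟩ := hT.of_reaches hQ _ hJ
    exact ⟨_, hm'.blowUp hJ ⟨s, hle⟩⟩

theorem HasMonomialPart.isMonomial {m : R.fabric.I → ℕ} (h : R.HasMonomialPart m)
    (hzero : ∀ K ∈ (R.comap Sum.inr).singular (fun _ => d),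
      ∃ s, ∑ i ∈ K, R.weight (.inl s) i = 0) :
    IsMonomial (fun _ => d) (R.comap Sum.inr) m := by
  refine ⟨fun s i => (Nat.le_add_right _ _).trans_eq (h s i).symm, fun K hK => ?_⟩
  obtain ⟨s, hs⟩ := hzero K hK
  refine ⟨s, fun i hi => (h s i).trans ?_⟩
  rw [Finset.sum_eq_zero_iff.1 hs i hi, add_zero]

theorem maximalContact_univ
    (hμ : ∀ K ∈ (R.comap Sum.inr).singular (fun _ => d),
      ∃ s, ∑ i ∈ K, R.weight (.inl s) i ≤ μ) :
    MaximalContact (sumThreshold α μ d) R (Set.range Sum.inl) Finset.univ := fun K hK => by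
  obtain ⟨s, hs⟩ := hμ K ⟨hK.1, fun s => hK.2 (.inr s)⟩
  exact ⟨.inl s, ⟨s, rfl⟩, hs, fun i _ hi => absurd (Finset.mem_univ i) hi⟩

theorem exists_sum_lt_of_singular_eq_empty (hR : R.singular (sumThreshold α μ d) = ∅)
    {K : Finset R.fabric.I} (hK : K ∈ (R.comap Sum.inr).singular fun _ => d) :
    ∃ s, ∑ i ∈ K, R.weight (.inl s) i < μ := by
  by_contra! hge
  exact Set.eq_empty_iff_forall_notMem.1 hR K ⟨hK.1, Sum.forall.2 ⟨hge, hK.2⟩⟩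

theorem HasMonomialPart.resolvable_comap_inr {n : ℕ} (hn : ResolvableInCard.{u, v} n)
    (hd : 0 < d) {m : R.fabric.I → ℕ} (h : R.HasMonomialPart m)
    (hR : R.fabric.StrataCardLE (n + 1))
    (hμ : ∀ K ∈ (R.comap Sum.inr).singular (fun _ => d),
      ∃ s, ∑ i ∈ K, R.weight (.inl s) i ≤ μ) :
    Resolvable (fun _ => d) (R.comap Sum.inr) := by
  induction μ generalizing R with
  | zero => exact (h.isMonomial (hμ · · |>.imp fun _ => Nat.le_zero.1)).resolvable
  | succ μ ih =>
    have hT := maximalContact_univ hμ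
    have hpos : ∀ s, 0 < sumThreshold α (μ + 1) d s :=
      Sum.forall.2 ⟨fun _ => μ.succ_pos, fun _ => hd⟩
    have hbdd : BddAbove (Set.range (sumThreshold α (μ + 1) d)) := by
      refine ⟨max (μ + 1) d, ?_⟩
      rintro _ ⟨_ | _, rfl⟩
      exacts [le_max_left _ _, le_max_right _ _]
    obtain ⟨Q, e, hQ, hempty⟩ := hT.resolvable hn hpos hbdd hR
    obtain ⟨m', hm'⟩ := h.of_reaches hT hQ
    exact (ih hm' (hQ.strataCardLE hR) fun K hK =>
      (exists_sum_lt_of_singular_eq_empty hempty hK).imp fun _ => Nat.le_of_lt_succ).of_reaches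
        (hQ.comap Sum.inr)

end MonomialPart

section Resolution

variable {α : Type v} [Nonempty α] {P : WeightedFabric.{u} α}

theorem ResolvableInCard.resolvable_const {n d : ℕ} (hn : ResolvableInCard.{u, v} n)
    (hd : 0 < d) (hP : P.fabric.StrataCardLE (n + 1)) : Resolvable (fun _ => d) P := by
  obtain ⟨s₀⟩ := ‹Nonempty α›
  have h : (P.comap (Sum.elim id id)).HasMonomialPart 0 := fun s i => (zero_add _).symm
  exact h.resolvable_comap_inr hn hd hP (μ := ∑ i, P.weight s₀ i) fun K _ =>
    ⟨s₀, Finset.sum_le_sum_of_subset K.subset_univ⟩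

theorem resolvableInCard (n : ℕ) : ResolvableInCard.{u, v} n := by
  induction n with
  | zero =>
    intro α ⟨s⟩ d P hd _ hP
    refine ⟨P, _, .refl, Set.eq_empty_of_forall_notMem fun K hK => (hd s).not_ge ?_⟩
    obtain rfl := Finset.card_eq_zero.1 (Nat.le_zero.1 (hP K hK.1))
    exact hK.2 s
  | succ n ih =>
    rintro α _ d P hd ⟨b, hb⟩ hP
    have hdvd s : d s ∣ b.factorial := Nat.dvd_factorial (hd s) (hb ⟨s, rfl⟩)
    refine Resolvable.of_scale (c := fun s => b.factorial / d s)
      (fun s => Nat.div_pos (Nat.le_of_dvd b.factorial_pos (hdvd s)) (hd s)) ?_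
    have hconst : (fun s => b.factorial / d s) * d = fun _ => b.factorial :=
      funext fun s => Nat.div_mul_cancel (hdvd s)
    rw [hconst]
    exact ih.resolvable_const b.factorial_pos hP

theorem resolvable {d : α → ℕ} (hd : ∀ s, 0 < d s) (hbdd : BddAbove (Set.range d)) :
    Resolvable d P :=
  resolvableInCard _ d P hd hbdd fun K _ => K.card_le_univ

end Resolution

end WeightedFabric

section PosConvexHull

variable {ι : Type*} {A : Set (ι → ℝ)}

theorem nonempty_of_nonempty_posConvexHull (h : (posConvexHull A).Nonempty) : A.Nonempty :=
  (convexHull_nonempty_iff.1 h).of_add_left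

theorem mem_posConvexHull_of_le {σ τ : ι → ℝ} (hσ : σ ∈ posConvexHull A) (hστ : σ ≤ τ) :
    τ ∈ posConvexHull A := by
  have h := posConvexHull_idem_aux hσ (τ := τ - σ) fun j => sub_nonneg.2 (hστ j)
  rwa [add_sub_cancel] at h

theorem forall_mem_posConvexHull_le_sum_iff [Fintype ι] {c : ℝ} :
    (∀ σ ∈ posConvexHull A, c ≤ ∑ j, σ j) ↔ ∀ σ ∈ A, c ≤ ∑ j, σ j := by
  refine ⟨fun h σ hσ => h σ (subset_posConvexHull A hσ), fun h => convexHull_min ?_ ?_⟩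
  · rintro _ ⟨σ, hσ, τ, hτ, rfl⟩
    refine (h σ hσ).trans (Finset.sum_le_sum fun j _ => ?_)
    exact le_add_of_nonneg_right (hτ j)
  · exact convex_halfSpace_ge
      (IsLinearMap.mk (fun _ _ => Finset.sum_add_distrib) fun _ _ => (Finset.mul_sum ..).symm) c

end PosConvexHull

section ContactExponent

variable {I : Type u} {J : Finset I}

theorem le_polyhedronContactExponent_posConvexHull_iff (hJ : J.Nonempty) {A : Set (J → ℝ)}
    (hA : A.Nonempty) (hnonneg : ∀ σ ∈ A, ∀ j, 0 ≤ σ j) {c : ℝ} :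
    c ≤ polyhedronContactExponent (posConvexHull A) ↔ ∀ σ ∈ A, c ≤ ∑ j, σ j := by
  have hbdd : BddBelow ((fun σ : J → ℝ => ∑ j, σ j) '' posConvexHull A) := by
    refine ⟨0, Set.forall_mem_image.2 fun σ hσ => Finset.sum_nonneg fun j _ => ?_⟩
    exact posConvexHull_nonneg hnonneg σ hσ j
  rw [polyhedronContactExponent, if_neg hJ.ne_empty,
    le_csInf_iff hbdd ((hA.mono (subset_posConvexHull A)).image _), Set.forall_mem_image,
    forall_mem_posConvexHull_le_sum_iff]

theorem polyhedronContactExponent_smul (hJ : J.Nonempty) {c : ℝ} (hc : 0 ≤ c)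
    (Δ : Set (J → ℝ)) :
    polyhedronContactExponent (c • Δ) = c * polyhedronContactExponent Δ := by
  rw [polyhedronContactExponent, polyhedronContactExponent, if_neg hJ.ne_empty,
    if_neg hJ.ne_empty, ← smul_eq_mul, ← Real.sInf_smul_of_nonneg hc, ← Set.image_smul,
    ← Set.image_smul, Set.image_image, Set.image_image]
  simp only [Pi.smul_apply, ← Finset.smul_sum]

end ContactExponent

/-- The vectors of `ℝ^J` obtained by restricting the weight vectors `w s` to `J`. -/
def weightVectors {α I : Type*} (w : α → I → ℕ) (J : Finset I) : Set (J → ℝ) :=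
  Set.range fun s (j : J) => (w s j : ℝ)

theorem smul_blowUpLin_sub_eInfty (F : SupportFabric.{u}) {d : ℕ} (hd : 0 < d) {J : Finset F.I}
    {w : F.I → ℕ} (hJ : d ≤ ∑ j ∈ J, w j) (J' : Finset (Option F.I)) :
    (d : ℝ) • (F.blowUpLin J J' ((1 / (d : ℝ)) • fun i : F.blowUpMap J J' => (w i : ℝ)) -
      SupportFabric.eInfty J') = fun o : J' => (blowUpWeight d J w o : ℝ) := by
  have hd0 : (d : ℝ) ≠ 0 := Nat.cast_ne_zero.2 hd.ne'
  funext ⟨o, ho⟩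
  cases o with
  | some i =>
    change (d : ℝ) * (1 / (d : ℝ) * (w i : ℝ) - 0) = (w i : ℝ)
    rw [sub_zero, one_div, mul_inv_cancel_left₀ hd0]
  | none =>
    change (d : ℝ) * (∑ j : J, 1 / (d : ℝ) * (w j : ℝ) - 1) = ((∑ j ∈ J, w j - d : ℕ) : ℝ)
    rw [Nat.cast_sub hJ, Nat.cast_sum, ← Finset.mul_sum, Finset.sum_coe_sort J fun j => (w j : ℝ)]
    field_simp

theorem smul_image_blowUpLin_weightVectors (F : SupportFabric.{u}) {α : Type*}
    {w : α → F.I → ℕ} {d : ℕ} (hd : 0 < d) {J : Finset F.I} (hJ : ∀ s, d ≤ ∑ j ∈ J, w s j)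
    (J' : Finset (Option F.I)) :
    (d : ℝ) • ((fun σ => σ - SupportFabric.eInfty J') ''
      (F.blowUpLin J J' '' ((1 / (d : ℝ)) • weightVectors w (F.blowUpMap J J')))) =
    weightVectors (fun s => blowUpWeight d J (w s)) J' := by
  simp only [weightVectors, ← Set.image_smul, ← Set.range_comp]
  exact congrArg Set.range (funext fun s => smul_blowUpLin_sub_eInfty F hd (hJ s) J')

namespace PolyhedraSystem

variable {α : Type v} {N : PolyhedraSystem.{u}} {d : ℕ}

theorem exists_mem_polyhedron_eq_on_inter (N : PolyhedraSystem.{u}) {J : N.fabric.strata}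
    {σ : J.1 → ℝ} (hσ : σ ∈ N.polyhedron J) (K : N.fabric.strata) :
    ∃ τ ∈ N.polyhedron K, ∀ i (hJ : i ∈ J.1) (hK : i ∈ K.1), τ ⟨i, hK⟩ = σ ⟨i, hJ⟩ := by
  have hJK : J.1 ∩ K.1 ∈ N.fabric.strata := N.fabric.isOpen _ J.2 _ Finset.inter_subset_left
  have hrestrict : Finset.restrict₂ (π := fun _ => ℝ) Finset.inter_subset_left σ ∈
      N.polyhedron ⟨J.1 ∩ K.1, hJK⟩ := by
    rw [N.compat ⟨J.1 ∩ K.1, hJK⟩ J Finset.inter_subset_left]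
    exact Set.mem_image_of_mem _ hσ
  rw [N.compat ⟨J.1 ∩ K.1, hJK⟩ K Finset.inter_subset_right] at hrestrict
  obtain ⟨τ, hτ, h⟩ := hrestrict
  exact ⟨τ, hτ, fun i hJ hK => congrFun h ⟨i, Finset.mem_inter.2 ⟨hJ, hK⟩⟩⟩

theorem mem_polyhedron_of_le {K : N.fabric.strata} {σ τ : K.1 → ℝ} (hσ : σ ∈ N.polyhedron K)
    (hστ : σ ≤ τ) : τ ∈ N.polyhedron K := by
  obtain ⟨A, -, hA⟩ := N.isChar K
  rw [hA] at hσ ⊢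
  exact mem_posConvexHull_of_le hσ hστ

/-- The natural vectors on the whole index set whose restriction to each stratum `K` lies in
`Δ_K`. -/
def globalLatticePoints (N : PolyhedraSystem.{u}) : Set (N.fabric.I → ℕ) :=
  {v | ∀ K : N.fabric.strata, (fun k : K.1 => (v k : ℝ)) ∈ N.polyhedron K}

theorem exists_mem_globalLatticePoints_eq (N : PolyhedraSystem.{u}) {J : N.fabric.strata}
    {n : J.1 → ℕ} (hn : (fun j => (n j : ℝ)) ∈ N.polyhedron J) :
    ∃ v ∈ N.globalLatticePoints, ∀ j : J.1, v j = n j := by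
  choose τ hτ hτn using N.exists_mem_polyhedron_eq_on_inter hn
  obtain ⟨M, hM⟩ : ∃ M : ℕ, ∀ x : Σ K : N.fabric.strata, K.1, τ x.1 x.2 ≤ M := by
    obtain ⟨r, hr⟩ :=
      (Set.finite_range fun x : Σ K : N.fabric.strata, K.1 => τ x.1 x.2).bddAbove
    obtain ⟨M, hM⟩ := exists_nat_ge r
    exact ⟨M, fun x => (hr ⟨x, rfl⟩).trans hM⟩
  refine ⟨fun i => if h : i ∈ J.1 then n ⟨i, h⟩ else M, fun K => ?_, fun j => dif_pos j.2⟩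
  refine mem_polyhedron_of_le (hτ K) fun k => ?_
  by_cases hk : k.1 ∈ J.1
  · simp only [dif_pos hk, ← hτn K k hk k.2, le_refl]
  · simpa only [dif_neg hk] using hM ⟨K, k⟩

/-- `N` is a Newton polyhedra system whose polyhedra are generated by the weight vectors `w`. -/
structure IsGeneratedBy (N : PolyhedraSystem.{u}) (w : α → N.fabric.I → ℕ) : Prop where
  isNewton : N.IsNewton
  polyhedron_eq (J : N.fabric.strata) : N.polyhedron J = posConvexHull (weightVectors w J)

theorem isGeneratedBy_globalLatticePoints (hN : N.IsNewton) :
    N.IsGeneratedBy fun v : N.globalLatticePoints => v.1 := by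
  refine ⟨hN, fun J => ?_⟩
  obtain ⟨A, hA, hJ⟩ := N.isChar J
  rw [hJ]
  apply subset_antisymm
  · refine posConvexHull_min fun σ hσ => subset_posConvexHull _ ?_
    choose n hn using hA σ hσ
    obtain rfl : σ = fun j => (n j : ℝ) :=
      funext fun j => by rw [hn j, show N.denom = 1 from hN, Nat.cast_one, div_one]
    obtain ⟨v, hv, hvn⟩ :=
      N.exists_mem_globalLatticePoints_eq (hJ ▸ subset_posConvexHull A hσ)
    exact ⟨⟨v, hv⟩, funext fun j => congrArg Nat.cast (hvn j)⟩
  · refine posConvexHull_min (Set.range_subset_iff.2 fun v => ?_)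
    exact hJ ▸ v.2 J

namespace IsGeneratedBy

variable {w : α → N.fabric.I → ℕ}

theorem nonempty_weightVectors (h : N.IsGeneratedBy w) (J : N.fabric.strata) :
    (weightVectors w J).Nonempty :=
  nonempty_of_nonempty_posConvexHull (h.polyhedron_eq J ▸ N.nonempty J)

theorem natCast_le_polyhedronContactExponent_iff (h : N.IsGeneratedBy w) (hd : 0 < d)
    (J : N.fabric.strata) :
    (d : ℝ) ≤ polyhedronContactExponent (N.polyhedron J) ↔ ∀ s, d ≤ ∑ j ∈ J.1, w s j := by
  have hne := h.nonempty_weightVectors J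
  rcases J.1.eq_empty_or_nonempty with hJ | hJ
  · obtain ⟨s⟩ := Set.range_nonempty_iff_nonempty.1 hne
    rw [polyhedronContactExponent, if_pos hJ]
    refine iff_of_false (by linarith [d.cast_nonneg (α := ℝ)]) fun hs => hd.not_ge ?_
    simpa only [hJ, Finset.sum_empty] using hs s
  · rw [h.polyhedron_eq, le_polyhedronContactExponent_posConvexHull_iff hJ hne
      (Set.forall_mem_range.2 fun s j => Nat.cast_nonneg _), weightVectors, Set.forall_mem_range]
    refine forall_congr' fun s => ?_
    rw [Finset.sum_coe_sort J.1 fun j => (w s j : ℝ)]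
    exact_mod_cast Iff.rfl

theorem contactExponent_lt (h : N.IsGeneratedBy w) (hd : 0 < d)
    (hempty : (WeightedFabric.mk N.fabric w).singular (fun _ => d) = ∅) :
    N.contactExponent < (d : EReal) := by
  have hlt (J : N.fabric.strata) : polyhedronContactExponent (N.polyhedron J) < d := by
    rw [← not_le, h.natCast_le_polyhedronContactExponent_iff hd]
    exact fun hJ => Set.eq_empty_iff_forall_notMem.1 hempty J.1 ⟨J.2, hJ⟩
  rw [contactExponent]
  rcases isEmpty_or_nonempty N.fabric.strata with _ | _
  · rw [iSup_of_empty]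
    exact EReal.bot_lt_coe d
  · obtain ⟨J, hJ⟩ := exists_eq_ciSup_of_finite (f := fun J : N.fabric.strata =>
      (polyhedronContactExponent (N.polyhedron J) : EReal))
    rw [← hJ]
    exact_mod_cast hlt J

theorem moderatedTransform (h : N.IsGeneratedBy w) (hd : 0 < d) {J : N.fabric.strata}
    (hsing : J ∈ (N.divBy d hd).Sing) (hJ : ∀ s, d ≤ ∑ j ∈ J.1, w s j) :
    (N.moderatedTransform d hd J hsing).IsGeneratedBy fun s => blowUpWeight d J.1 (w s) := by
  have hd' : (0 : ℝ) < d := Nat.cast_pos.2 hd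
  refine ⟨rfl, fun J' => ?_⟩
  have hdiv (K : N.fabric.strata) : (N.divBy d hd).polyhedron K =
      posConvexHull ((1 / (d : ℝ)) • weightVectors w K) := by
    rw [← smul_posConvexHull (one_div_pos.2 hd'), ← h.polyhedron_eq]
    rfl
  change ((N.denom * d : ℕ) : ℝ) • ((fun σ => σ - SupportFabric.eInfty J'.1) ''
    (N.divBy d hd).totalPolyhedron J J') = _
  rw [(N.divBy d hd).totalPolyhedron_eq_aux J J' _ (hdiv _), image_sub_posConvexHull,
    show N.denom = 1 from h.isNewton, one_mul, smul_posConvexHull hd']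
  exact congrArg posConvexHull (smul_image_blowUpLin_weightVectors N.fabric hd hJ J'.1)

end IsGeneratedBy

theorem nonempty_globalLatticePoints (hN : N.IsNewton) : N.globalLatticePoints.Nonempty := by
  rcases isEmpty_or_nonempty N.fabric.strata with _ | ⟨⟨J⟩⟩
  · exact ⟨0, isEmptyElim⟩
  · have hne := (isGeneratedBy_globalLatticePoints hN).nonempty_weightVectors J
    exact Set.nonempty_coe_sort.1 (Set.range_nonempty_iff_nonempty.1 hne)

theorem mem_sing_divBy_iff (hd : 0 < d) (J : N.fabric.strata) :
    J ∈ (N.divBy d hd).Sing ↔ (d : ℝ) ≤ polyhedronContactExponent (N.polyhedron J) := by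
  have hd' : (0 : ℝ) < d := Nat.cast_pos.2 hd
  change 1 ≤ polyhedronContactExponent ((1 / (d : ℝ)) • N.polyhedron J) ↔ _
  rcases J.1.eq_empty_or_nonempty with hJ | hJ
  · rw [polyhedronContactExponent, polyhedronContactExponent, if_pos hJ, if_pos hJ]
    exact iff_of_false (by norm_num) (by linarith)
  · rw [polyhedronContactExponent_smul hJ (one_div_pos.2 hd').le, one_div_mul_eq_div,
      one_le_div₀ hd']

theorem IsGeneratedBy.exists_reflTransGen {w : α → N.fabric.I → ℕ} (h : N.IsGeneratedBy w)
    (hd : 0 < d) {Q : WeightedFabric.{u} α}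
    {e : (WeightedFabric.mk N.fabric w).fabric.I ↪ Q.fabric.I}
    (hQ : WeightedFabric.Reaches (fun _ => d) ⟨N.fabric, w⟩ Q e) :
    ∃ (N' : PolyhedraSystem.{u}) (w' : α → N'.fabric.I → ℕ), N'.IsGeneratedBy w' ∧
      Q = ⟨N'.fabric, w'⟩ ∧ Relation.ReflTransGen (IsModeratedTransform d hd) N N' := by
  induction hQ with
  | refl => exact ⟨N, w, h, rfl, .refl⟩
  | blowUp _ hJ ih =>
    obtain ⟨N', w', h', rfl, hN'⟩ := ih
    have hsing := (mem_sing_divBy_iff hd ⟨_, hJ.1⟩).2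
      ((h'.natCast_le_polyhedronContactExponent_iff hd _).2 hJ.2)
    exact ⟨_, _, h'.moderatedTransform hd hsing hJ.2, rfl, hN'.tail ⟨_, hsing, rfl⟩⟩

end PolyhedraSystem

theorem exists_seq_of_reflTransGen {β : Type*} {r : β → β → Prop} {a b : β}
    (h : Relation.ReflTransGen r a b) :
    ∃ (k : ℕ) (S : ℕ → β), S 0 = a ∧ (∀ i < k, r (S i) (S (i + 1))) ∧ S k = b := by
  induction h using Relation.ReflTransGen.head_induction_on with
  | refl => exact ⟨0, fun _ => b, rfl, fun i hi => absurd hi i.not_lt_zero, rfl⟩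
  | @head a _ hac _ ih =>
    obtain ⟨k, S, rfl, hS, hk⟩ := ih
    refine ⟨k + 1, fun i => i.casesOn a S, rfl, ?_, hk⟩
    rintro (_ | i) hi
    · exact hac
    · exact hS i (Nat.lt_of_succ_lt_succ hi)

theorem mainTheorem3 (N : PolyhedraSystem.{u}) (hN : N.IsNewton) (d : ℕ) (hd : 0 < d) :
    ∃ (k : ℕ) (S : ℕ → PolyhedraSystem.{u}), S 0 = N ∧
      (∀ i < k, PolyhedraSystem.IsModeratedTransform d hd (S i) (S (i + 1))) ∧
      (S k).contactExponent < (d : EReal) := by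
  have := (PolyhedraSystem.nonempty_globalLatticePoints hN).to_subtype
  have hgen := PolyhedraSystem.isGeneratedBy_globalLatticePoints hN
  have hbdd : BddAbove (Set.range fun _ : N.globalLatticePoints => d) :=
    Set.finite_range_const.bddAbove
  obtain ⟨Q, e, hQ, hempty⟩ := WeightedFabric.resolvable (P := ⟨N.fabric, _⟩) (fun _ => hd) hbdd
  obtain ⟨N', w', hgen', rfl, hN'⟩ := hgen.exists_reflTransGen hd hQ
  obtain ⟨k, S, h0, hS, rfl⟩ := exists_seq_of_reflTransGen hN'
  exact ⟨k, S, h0, hS, hgen'.contactExponent_lt hd hempty⟩
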